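/- Let $V$ be an $n$-dimensional Euclidean space (for instance $\mathbb R^n$) and let $I\subset\mathbb R$ be an interval with more than one point. A curve $c:I\to V$ is called strongly regular if it is $n$ times continuously differentiable on $I$ (with one-sided derivatives at the endpoints that belong to $I$) and the vectors $c'(t),\dots,c^{(n)}(t)$ are linearly independent for every $t\in I$. Let $c,d:I\to V$ be strongly regular curves with $\|c^{(k)}(t)\|=\|d^{(k)}(t)\|$ for all $1\le k\le n$ and all $t\in I$. 1. There is an isometry $g$ of $V$ (not necessarily orientation preserving) such that $d(t)=g(c(t))$ for all $t\in I$. 2. Fix an orientation of $V$, and let $\det$ be the determinant with respect to positively oriented orthonormal bases of $V$. For every strongly regular curve $c:I\to V$, the sign of $\det(c'(t),\dots,c^{(n)}(t))$ does not depend on $t\in I$; denote it by $\operatorname{sgn}(c)\in\{1,-1\}$. If, in addition to the above equality of norms, $\operatorname{sgn}(c)=\operatorname{sgn}(d)$, then there is an orientation preserving isometry $g$ of $V$ such that $d(t)=g(c(t))$ for all $t\in I$. -/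

import Mathlib

open Set

noncomputable section

/-- The vectors `c'(t), …, c⁽ⁿ⁾(t)`. The derivatives are taken within the interval `I` on which the
curve is defined, so they are one-sided at an endpoint of `I` that belongs to `I`. -/
def curveDerivs {V : Type*} [NormedAddCommGroup V] [InnerProductSpace ℝ V]
    (n : ℕ) (I : Set ℝ) (c : ℝ → V) (t : ℝ) : Fin n → V :=
  fun i => iteratedDerivWithin (i.val + 1) c I t

/-- A strongly regular curve `c : I → V` (only the values of `c` on `I` matter): it is `n` times
continuously differentiable, and `c'(t), …, c⁽ⁿ⁾(t)` are linearly independent for all `t ∈ I`. -/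
structure IsStronglyRegular {V : Type*} [NormedAddCommGroup V] [InnerProductSpace ℝ V]
    (n : ℕ) (I : Set ℝ) (c : ℝ → V) : Prop where
  contDiffOn : ContDiffOn ℝ n c I
  linearIndependent : ∀ t ∈ I, LinearIndependent ℝ (curveDerivs n I c t)

/-- The two curves have the same functions `‖c'‖, …, ‖c⁽ⁿ⁾‖` on `I`. -/
def SameDerivNorms {V : Type*} [NormedAddCommGroup V] [InnerProductSpace ℝ V]
    (n : ℕ) (I : Set ℝ) (c d : ℝ → V) : Prop :=
  ∀ k : ℕ, 1 ≤ k → k ≤ n → ∀ t ∈ I,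
    ‖iteratedDerivWithin k c I t‖ = ‖iteratedDerivWithin k d I t‖

/-- `sgn(c(t))`, the sign of `det(c'(t), …, c⁽ⁿ⁾(t))`. The determinant on an oriented Euclidean
space is its volume form: the determinant of the coordinates in any positively oriented
orthonormal basis. -/
def curveSgn {V : Type*} [NormedAddCommGroup V] [InnerProductSpace ℝ V]
    {n : ℕ} [Fact (Module.finrank ℝ V = n)] (o : Orientation ℝ V (Fin n))
    (I : Set ℝ) (c : ℝ → V) (t : ℝ) : SignType :=
  SignType.sign (o.volumeForm (curveDerivs n I c t))

/-- `sgn(c) = σ`, that is, `sgn(c(t)) = σ` for all `t ∈ I`. -/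
def HasSgn {V : Type*} [NormedAddCommGroup V] [InnerProductSpace ℝ V]
    {n : ℕ} [Fact (Module.finrank ℝ V = n)] (o : Orientation ℝ V (Fin n))
    (I : Set ℝ) (c : ℝ → V) (σ : SignType) : Prop :=
  ∀ t ∈ I, curveSgn o I c t = σ

end

/-! Differentiating inner products shows that the norms determine the whole Gram matrix of `c', …,
c⁽ⁿ⁾` (`SameDerivNorms.inner_eq`), so at each `t` a linear isometry `A t` carries the frame of `c`
to that of `d`. It remains to see that `A` is constant. Formally, differentiating `A c⁽ⁱ⁾ = d⁽ⁱ⁾`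
gives `A' c⁽ⁱ⁾ = 0` for `i < n`. Since `A⁻¹A'` is skew and vanishes on a hyperplane, its rank is
even and at most 1, hence `A' = 0`.

As `c⁽ⁿ⁾` is only continuous, `A` is not known in advance to be differentiable. The argument is
therefore run with little-o estimates, the skewness step being
`isLittleO_isometry_apply_sub_of_forall_ne`. A constant linear part makes `d - A c` constant, and
the sign of the volume form decides orientation. -/

/-! ### Families of linear isometries and their pointwise derivatives -/

section IsometryFamily

open Filter Asymptotics Topology RealInnerProductSpace

variable {V : Type*} [NormedAddCommGroup V] [InnerProductSpace ℝ V]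

/-- Two bases with the same Gram matrix differ by a linear isometry. -/
theorem exists_linearIsometryEquiv_of_inner_eq {ι : Type*} (e f : Module.Basis ι ℝ V)
    (h : ∀ i j, ⟪e i, e j⟫ = ⟪f i, f j⟫) : ∃ g : V ≃ₗᵢ[ℝ] V, ∀ i, g (e i) = f i := by
  let φ : V ≃ₗ[ℝ] V := e.equiv f (Equiv.refl ι)
  have hφ : ∀ i, φ (e i) = f i := fun i => by simp [φ]
  have hB : (innerₗ V).compl₁₂ φ.toLinearMap φ.toLinearMap = innerₗ V := by
    refine e.ext fun i => e.ext fun j => ?_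
    simp [hφ, h]
  refine ⟨φ.isometryOfInner fun x y => ?_, hφ⟩
  simpa using LinearMap.congr_fun₂ hB x y

/-- If linear isometries `A t` map `a i t` to `b i t`, where the `a i t` and the `b i t` depend
continuously on `t` and the `a i s` span, then `A t` converges pointwise to `A s`. -/
theorem tendsto_isometry_apply_sub {ι : Type*} {I : Set ℝ} {s : ℝ} (hs : s ∈ I)
    {a b : ι → ℝ → V} {A : ℝ → V ≃ₗᵢ[ℝ] V} (hA : ∀ t ∈ I, ∀ i, A t (a i t) = b i t)
    (ha : ∀ i, ContinuousWithinAt (a i) I s) (hb : ∀ i, ContinuousWithinAt (b i) I s)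
    (hspan : Submodule.span ℝ (Set.range fun i => a i s) = ⊤) (x : V) :
    Tendsto (fun t => A t x - A s x) (𝓝[I] s) (𝓝 0) := by
  have hx : x ∈ Submodule.span ℝ (Set.range fun i => a i s) := hspan ▸ Submodule.mem_top
  induction hx using Submodule.span_induction with
  | mem x h =>
    obtain ⟨i, rfl⟩ := h
    have h1 : Tendsto (fun t => A t (a i s - a i t)) (𝓝[I] s) (𝓝 0) := by
      rw [tendsto_zero_iff_norm_tendsto_zero]
      simpa only [LinearIsometryEquiv.norm_map, sub_self, norm_zero] using
        ((tendsto_const_nhds (x := a i s)).sub (ha i).tendsto).norm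
    have h2 : Tendsto (fun t => b i t - b i s) (𝓝[I] s) (𝓝 0) := by
      simpa using (hb i).tendsto.sub (tendsto_const_nhds (x := b i s))
    have h3 := h1.add h2
    rw [add_zero] at h3
    refine h3.congr' ?_
    filter_upwards [self_mem_nhdsWithin] with t ht
    rw [map_sub, hA t ht i, hA s hs i]
    abel
  | zero => simpa using tendsto_const_nhds
  | add x y _ _ hx hy =>
    have h := hx.add hy
    rw [add_zero] at h
    refine h.congr fun t => ?_
    simp only [map_add]
    abel
  | smul r x _ hx =>
    have h := hx.const_smul r
    rw [smul_zero] at h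
    refine h.congr fun t => ?_
    simp only [map_smul, smul_sub]

/-- A family of linear isometries that maps `a t` to `b t` has derivative zero at `s` on `a s`
if it converges on the derivative of `a` and its limit `A s` maps this derivative to the derivative of `b`. -/
theorem isLittleO_isometry_apply_sub {I : Set ℝ} {s : ℝ} (hs : s ∈ I)
    {a b : ℝ → V} {a₁ b₁ : V} {A : ℝ → V ≃ₗᵢ[ℝ] V} (hA : ∀ t ∈ I, A t (a t) = b t)
    (ha : HasDerivWithinAt a a₁ I s) (hb : HasDerivWithinAt b b₁ I s) (hA₁ : A s a₁ = b₁)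
    (hlim : Tendsto (fun t => A t a₁ - A s a₁) (𝓝[I] s) (𝓝 0)) :
    (fun t => A t (a s) - A s (a s)) =o[𝓝[I] s] fun t => t - s := by
  have h1 : (fun t => A t (a t - a s - (t - s) • a₁)) =o[𝓝[I] s] fun t => t - s := by
    rw [← isLittleO_norm_left]
    simpa only [LinearIsometryEquiv.norm_map, isLittleO_norm_left] using ha.isLittleO
  have h2 : (fun t => (t - s) • (A t a₁ - A s a₁)) =o[𝓝[I] s] fun t => t - s := by
    have := (isBigO_refl (fun t => t - s) (𝓝[I] s)).smul_isLittleO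
      ((isLittleO_one_iff ℝ).2 hlim)
    simpa using this
  -- The difference is the Taylor remainder of `b`, minus `A t` of that of `a`, minus the term in
  -- `h2`; the linear terms cancel because `A s a₁ = b₁`.
  refine ((hb.isLittleO.sub h1).sub h2).congr' ?_ .rfl
  filter_upwards [self_mem_nhdsWithin] with t ht
  simp only [map_sub, map_smul, smul_sub, hA t ht, hA s hs, hA₁]
  abel

/-- A family of linear isometries converging pointwise to `A s` whose derivative at `s` vanishes on
all vectors but one of a spanning family has derivative zero at `s`. -/
theorem isLittleO_isometry_apply_sub_of_forall_ne [FiniteDimensional ℝ V] {ι : Type*} [Fintype ι]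
    {l : Filter ℝ} {u : ℝ → ℝ} {e : ι → V} (he : Submodule.span ℝ (Set.range e) = ⊤)
    {A : ℝ → V ≃ₗᵢ[ℝ] V} {B : V ≃ₗᵢ[ℝ] V} {j : ι}
    (hlim : Tendsto (fun t => A t (e j) - B (e j)) l (𝓝 0))
    (h : ∀ i ≠ j, (fun t => A t (e i) - B (e i)) =o[l] u) (x : V) :
    (fun t => A t x - B x) =o[l] u := by
  have hj : (fun t => A t (e j) - B (e j)) =o[l] u := by
    -- The vectors `B (e i)` span, so the inner products with them control the norm.
    let T : V →ₗ[ℝ] (ι → ℝ) := LinearMap.pi fun i => innerₗ V (B (e i))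
    have hT : LinearMap.ker T = ⊥ := by
      refine (LinearMap.ker_eq_bot').2 fun m hm => ?_
      have h0 : ∀ y ∈ Submodule.span ℝ (Set.range e), ⟪y, B.symm m⟫ = 0 := by
        intro y hy
        induction hy using Submodule.span_induction with
        | mem y hy =>
          obtain ⟨i, rfl⟩ := hy
          have := congrFun hm i
          rw [← B.inner_map_map, B.apply_symm_apply]
          simpa [T] using this
        | zero => simp
        | add y z _ _ hy hz => rw [inner_add_left, hy, hz, add_zero]
        | smul r y _ hy => rw [inner_smul_left, hy, mul_zero]
      have := h0 (B.symm m) (he ▸ Submodule.mem_top)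
      simpa using this
    obtain ⟨K, -, hK⟩ := T.exists_antilipschitzWith hT
    set δ : ℝ → V := fun t => A t (e j) - B (e j) with hδ
    have hδT : δ =O[l] fun t => T (δ t) := by
      refine IsBigO.of_bound K (Eventually.of_forall fun t => ?_)
      simpa using hK.le_mul_dist (δ t) 0
    have hsum : (fun t => T (δ t)) =o[l] fun t => ‖u t‖ + ‖δ t‖ := by
      refine isLittleO_pi.2 fun i => ?_
      by_cases hi : i = j
      · subst hi
        -- Equality of the norms of `A t (e j)` and `B (e j)` gives `⟪B (e j), δ⟫ = -‖δ‖²/2`, of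
        -- second order in `δ`.
        have h1 : (fun t => ‖δ t‖ * ‖δ t‖) =o[l] fun t => ‖δ t‖ := by
          simpa using
            ((isLittleO_one_iff ℝ).2 (tendsto_zero_iff_norm_tendsto_zero.1 hlim)).mul_isBigO
              (isBigO_refl (fun t => ‖δ t‖) l)
        have h2 : (fun t => ‖δ t‖) =O[l] fun t => ‖u t‖ + ‖δ t‖ :=
          IsBigO.of_bound 1 (Eventually.of_forall fun t => by
            rw [one_mul, Real.norm_of_nonneg (by positivity), Real.norm_of_nonneg (by positivity)]
            linarith [norm_nonneg (u t)])
        refine ((h1.trans_isBigO h2).const_mul_left (-(1 / 2))).congr_left fun t => ?_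
        have h3 : ‖δ t‖ * ‖δ t‖ = ⟪δ t, δ t⟫ := (real_inner_self_eq_norm_mul_norm _).symm
        have h4 : ⟪A t (e i), A t (e i)⟫ = ⟪B (e i), B (e i)⟫ := by simp
        have h5 := real_inner_comm (A t (e i)) (B (e i))
        simp only [T, LinearMap.pi_apply, innerₗ_apply_apply]
        rw [h3]
        simp only [hδ, inner_sub_left, inner_sub_right]
        linarith
      -- Preservation of `⟪e j, e i⟫` moves the variation onto `e i`, where it is known to be
      -- `o(u)`.
      · have h1 : (fun t => ⟪A t (e j), A t (e i) - B (e i)⟫) =O[l]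
            fun t => A t (e i) - B (e i) := by
          refine IsBigO.of_bound ‖e j‖ (Eventually.of_forall fun t => ?_)
          simpa using norm_inner_le_norm (𝕜 := ℝ) (A t (e j)) (A t (e i) - B (e i))
        have h2 : u =O[l] fun t => ‖u t‖ + ‖δ t‖ :=
          IsBigO.of_bound 1 (Eventually.of_forall fun t => by
            rw [one_mul, Real.norm_of_nonneg (add_nonneg (norm_nonneg _) (norm_nonneg _))]
            linarith [norm_nonneg (δ t)])
        refine ((h1.trans_isLittleO (h i hi)).trans_isBigO h2).neg_left.congr_left fun t => ?_
        have h4 : ⟪A t (e j), A t (e i)⟫ = ⟪B (e j), B (e i)⟫ := by simp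
        simp only [T, LinearMap.pi_apply, innerₗ_apply_apply]
        simp only [hδ, inner_sub_right]
        rw [real_inner_comm (A t (e j)) (B (e i)), real_inner_comm (B (e j)) (B (e i))]
        linarith
    have hself := hδT.trans_isLittleO hsum
    -- Absorb `δ` on the right: `‖δ‖ ≤ c/(1+c) · (‖u‖ + ‖δ‖)` is equivalent to `‖δ‖ ≤ c ‖u‖`.
    refine isLittleO_iff.2 fun c hc => ?_
    have hc' : 0 < c / (1 + c) := by positivity
    filter_upwards [isLittleO_iff.1 hself hc'] with t ht
    rw [Real.norm_of_nonneg (add_nonneg (norm_nonneg _) (norm_nonneg _)), div_mul_eq_mul_div,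
      le_div_iff₀ (by positivity)] at ht
    linarith
  have hx : x ∈ Submodule.span ℝ (Set.range e) := he ▸ Submodule.mem_top
  induction hx using Submodule.span_induction with
  | mem x hx =>
    obtain ⟨i, rfl⟩ := hx
    by_cases hi : i = j
    · exact hi ▸ hj
    · exact h i hi
  | zero => simp
  | add x y _ _ hx hy =>
    refine (hx.add hy).congr_left fun t => ?_
    simp only [map_add]
    abel
  | smul r x _ hx =>
    refine (hx.const_smul_left r).congr_left fun t => ?_
    simp only [Pi.smul_apply, map_smul, smul_sub]

end IsometryFamily

/-! ### Strongly regular curves: Gram matrices, congruence, orientation -/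

section Curves

open Filter Asymptotics Topology RealInnerProductSpace

variable {V : Type*} [NormedAddCommGroup V] [InnerProductSpace ℝ V]

theorem Set.OrdConnected.uniqueDiffOn_of_nontrivial {I : Set ℝ} (hI : I.OrdConnected)
    (h : I.Nontrivial) : UniqueDiffOn ℝ I :=
  uniqueDiffOn_convex hI.convex (hI.convex.nontrivial_iff_nonempty_interior.1 h)

theorem ContDiffOn.hasDerivWithinAt_iteratedDerivWithin {n : ℕ} {I : Set ℝ} {c : ℝ → V}
    (hc : ContDiffOn ℝ n c I) (hI : UniqueDiffOn ℝ I) {k : ℕ} (hk : k < n) {t : ℝ} (ht : t ∈ I) :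
    HasDerivWithinAt (iteratedDerivWithin k c I) (iteratedDerivWithin (k + 1) c I t) I t := by
  rw [iteratedDerivWithin_succ]
  exact (hc.differentiableOn_iteratedDerivWithin (by exact_mod_cast hk) hI t ht).hasDerivWithinAt

theorem HasDerivWithinAt.eq_of_eqOn {I : Set ℝ} (hI : UniqueDiffOn ℝ I) {f g : ℝ → V} {f' g' : V}
    {t : ℝ} (ht : t ∈ I) (hf : HasDerivWithinAt f f' I t) (hg : HasDerivWithinAt g g' I t)
    (h : Set.EqOn f g I) : f' = g' :=
  (hI t ht).eq_deriv _ hf (hg.congr h (h ht))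

/-- The norms of the derivatives determine their inner products. -/
theorem SameDerivNorms.inner_eq {n : ℕ} {I : Set ℝ} {c d : ℝ → V} (h : SameDerivNorms n I c d)
    (hI : UniqueDiffOn ℝ I) (hc : ContDiffOn ℝ n c I) (hd : ContDiffOn ℝ n d I) (m : ℕ) :
    ∀ k, 1 ≤ k → k + m ≤ n → ∀ t ∈ I,
      ⟪iteratedDerivWithin k c I t, iteratedDerivWithin (k + m) c I t⟫ =
        ⟪iteratedDerivWithin k d I t, iteratedDerivWithin (k + m) d I t⟫ := by
  induction m using Nat.strong_induction_on with
  | _ m ih =>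
    intro k hk hkm t ht
    rcases m with _ | m
    · simp only [add_zero, real_inner_self_eq_norm_sq, h k hk hkm t ht]
    -- The derivative of `⟪c⁽ᵏ⁾, c⁽ᵏ⁺ᵐ⁾⟫` contains the wanted product with gap `m + 1` and one with
    -- gap `m - 1`, known by induction; for `m = 0` the two coincide by symmetry.
    · have key := HasDerivWithinAt.eq_of_eqOn hI ht
        ((hc.hasDerivWithinAt_iteratedDerivWithin hI (k := k) (by omega) ht).inner ℝ
          (hc.hasDerivWithinAt_iteratedDerivWithin hI (k := k + m) (by omega) ht))
        ((hd.hasDerivWithinAt_iteratedDerivWithin hI (k := k) (by omega) ht).inner ℝ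
          (hd.hasDerivWithinAt_iteratedDerivWithin hI (k := k + m) (by omega) ht))
        (fun τ hτ => ih m (Nat.lt_succ_self m) k hk (by omega) τ hτ)
      rw [← add_assoc]
      rcases m with _ | m
      · simp only [add_zero] at key ⊢
        rw [real_inner_comm (iteratedDerivWithin k c I t),
          real_inner_comm (iteratedDerivWithin k d I t)] at key
        linarith
      · have h2 := ih m (by omega) (k + 1) (by omega) (by omega) t ht
        rw [show k + 1 + m = k + (m + 1) by omega] at h2
        linarith

theorem SameDerivNorms.inner_curveDerivs_eq {n : ℕ} {I : Set ℝ} {c d : ℝ → V}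
    (h : SameDerivNorms n I c d) (hI : UniqueDiffOn ℝ I) (hc : ContDiffOn ℝ n c I)
    (hd : ContDiffOn ℝ n d I) {t : ℝ} (ht : t ∈ I) (i j : Fin n) :
    ⟪curveDerivs n I c t i, curveDerivs n I c t j⟫ =
      ⟪curveDerivs n I d t i, curveDerivs n I d t j⟫ := by
  wlog hij : i ≤ j generalizing i j
  · rw [real_inner_comm, this j i (le_of_not_ge hij), real_inner_comm]
  · have hij' : i.val ≤ j.val := hij
    have := h.inner_eq hI hc hd (j - i) (i + 1) (by omega) (by omega) t ht
    rwa [show i.val + 1 + (j - i) = j + 1 by omega] at this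

variable {n : ℕ} {I : Set ℝ} {c d : ℝ → V}

theorem IsStronglyRegular.continuousOn_curveDerivs (hc : IsStronglyRegular n I c)
    (hI : UniqueDiffOn ℝ I) (i : Fin n) : ContinuousOn (fun t => curveDerivs n I c t i) I :=
  hc.contDiffOn.continuousOn_iteratedDerivWithin (by exact_mod_cast i.isLt) hI

theorem IsStronglyRegular.hasDerivWithinAt_curveDerivs (hc : IsStronglyRegular n I c)
    (hI : UniqueDiffOn ℝ I) (i : Fin n) (hi : i.val + 1 < n) {t : ℝ} (ht : t ∈ I) :
    HasDerivWithinAt (fun t => curveDerivs n I c t i) (curveDerivs n I c t ⟨i + 1, hi⟩) I t :=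
  hc.contDiffOn.hasDerivWithinAt_iteratedDerivWithin hI hi ht

theorem eqOn_of_hasDerivWithinAt_zero (hI : I.OrdConnected) {f : ℝ → V}
    (hf : ∀ t ∈ I, HasDerivWithinAt f 0 I t) {s t : ℝ} (hs : s ∈ I) (ht : t ∈ I) : f t = f s := by
  have := hI.convex.norm_image_sub_le_of_norm_hasDerivWithin_le (f' := fun _ => (0 : V)) (C := 0)
    hf (by simp) hs ht
  simpa [sub_eq_zero] using this

theorem Orientation.continuousOn_volumeForm_apply [Fact (Module.finrank ℝ V = n)]
    (o : Orientation ℝ V (Fin n))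
    {v : ℝ → Fin n → V} (hv : ∀ i, ContinuousOn (fun t => v t i) I) :
    ContinuousOn (fun t => o.volumeForm (v t)) I := by
  have hcont : Continuous o.volumeForm :=
    (o.volumeForm.mkContinuous 1 fun m => by
      simpa using o.abs_volumeForm_apply_le m).cont
  exact hcont.comp_continuousOn (continuousOn_pi.2 hv)

variable [FiniteDimensional ℝ V] [Fact (Module.finrank ℝ V = n)]

theorem IsStronglyRegular.exists_basis (hc : IsStronglyRegular n I c) {t : ℝ} (ht : t ∈ I) :
    ∃ e : Module.Basis (Fin n) ℝ V, ⇑e = curveDerivs n I c t := by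
  have h : Module.finrank ℝ V = n := Fact.out
  rcases n with _ | n
  · have : Subsingleton V := Module.finrank_zero_iff.1 h
    exact ⟨Module.Basis.empty V, funext fun i => i.elim0⟩
  · exact ⟨basisOfLinearIndependentOfCardEqFinrank (hc.linearIndependent t ht) (by simp [h]),
      by simp⟩

theorem IsStronglyRegular.span_curveDerivs (hc : IsStronglyRegular n I c) {t : ℝ} (ht : t ∈ I) :
    Submodule.span ℝ (Set.range (curveDerivs n I c t)) = ⊤ := by
  obtain ⟨e, he⟩ := hc.exists_basis ht
  rw [← he, e.span_eq]

/-- A single linear isometry maps the derivatives of `c` to those of `d`. -/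
theorem SameDerivNorms.exists_linearIsometryEquiv (h : SameDerivNorms n I c d)
    (hI : I.OrdConnected) (hI' : I.Nontrivial) (hc : IsStronglyRegular n I c)
    (hd : IsStronglyRegular n I d) :
    ∃ g : V ≃ₗᵢ[ℝ] V, ∀ t ∈ I, ∀ i, g (curveDerivs n I c t i) = curveDerivs n I d t i := by
  have hU := hI.uniqueDiffOn_of_nontrivial hI'
  have hex : ∀ t ∈ I, ∃ g : V ≃ₗᵢ[ℝ] V, ∀ i, g (curveDerivs n I c t i) = curveDerivs n I d t i := by
    intro t ht
    obtain ⟨e, he⟩ := hc.exists_basis ht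
    obtain ⟨f, hf⟩ := hd.exists_basis ht
    obtain ⟨g, hg⟩ := exists_linearIsometryEquiv_of_inner_eq e f fun i j => by
      rw [he, hf]
      exact h.inner_curveDerivs_eq hU hc.contDiffOn hd.contDiffOn ht i j
    exact ⟨g, fun i => by rw [← he, ← hf, hg]⟩
  rcases n with _ | n
  · exact ⟨.refl ℝ V, fun _ _ i => i.elim0⟩
  choose! A hA using hex
  obtain ⟨s, hs⟩ := hI'.nonempty
  refine ⟨A s, fun t ht i => ?_⟩
  rw [← hA t ht i]
  -- The vector stays frozen at time `t`; only the isometry varies with `τ`.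
  refine eqOn_of_hasDerivWithinAt_zero hI (f := fun τ => A τ (curveDerivs (n + 1) I c t i))
    (fun τ hτ => ?_) ht hs
  have hlim := tendsto_isometry_apply_sub hτ hA
    (fun i => hc.continuousOn_curveDerivs hU i τ hτ)
    (fun i => hd.continuousOn_curveDerivs hU i τ hτ) (hc.span_curveDerivs hτ)
  -- The exceptional vector is the top derivative, the only one that need not be differentiable.
  have key := isLittleO_isometry_apply_sub_of_forall_ne (hc.span_curveDerivs hτ)
    (j := Fin.last n) (hlim _) (u := fun t => t - τ) (fun i hi => by
      have hi' : i.val + 1 < n + 1 := by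
        have := Fin.val_lt_last hi
        omega
      exact isLittleO_isometry_apply_sub hτ (fun t ht => hA t ht i)
        (hc.hasDerivWithinAt_curveDerivs hU i hi' hτ)
        (hd.hasDerivWithinAt_curveDerivs hU i hi' hτ) (hA τ hτ _) (hlim _))
    (curveDerivs (n + 1) I c t i)
  rw [hasDerivWithinAt_iff_isLittleO]
  simpa using key

/-- A single isometry maps `c` to `d`, and its linear part maps the derivatives of `c` to those
of `d`. -/
theorem SameDerivNorms.exists_affineIsometryEquiv (h : SameDerivNorms n I c d)
    (hI : I.OrdConnected) (hI' : I.Nontrivial) (hc : IsStronglyRegular n I c)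
    (hd : IsStronglyRegular n I d) :
    ∃ g : V ≃ᵃⁱ[ℝ] V, (∀ t ∈ I, d t = g (c t)) ∧ ∀ t ∈ I, ∀ i,
      g.linearIsometryEquiv (curveDerivs n I c t i) = curveDerivs n I d t i := by
  have hU := hI.uniqueDiffOn_of_nontrivial hI'
  obtain ⟨L, hL⟩ := h.exists_linearIsometryEquiv hI hI' hc hd
  obtain ⟨s, hs⟩ := hI'.nonempty
  refine ⟨L.toAffineIsometryEquiv.trans (.constVAdd ℝ V (d s - L (c s))), fun t ht => ?_, hL⟩
  suffices hconst : d t - L (c t) = d s - L (c s) by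
    simp [← hconst]
  rcases n with _ | n
  · have : Subsingleton V := Module.finrank_zero_iff.1 (Fact.out : Module.finrank ℝ V = 0)
    exact Subsingleton.elim _ _
  refine eqOn_of_hasDerivWithinAt_zero hI (f := fun τ => d τ - L (c τ)) (fun τ hτ => ?_) hs ht
  have hc1 := hc.contDiffOn.hasDerivWithinAt_iteratedDerivWithin hU n.succ_pos hτ
  have hd1 := hd.contDiffOn.hasDerivWithinAt_iteratedDerivWithin hU n.succ_pos hτ
  rw [iteratedDerivWithin_zero] at hc1 hd1
  have hLc := (L : V →L[ℝ] V).hasFDerivAt.comp_hasDerivWithinAt τ hc1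
  have hsub := hd1.sub hLc
  have h0 : L (iteratedDerivWithin (0 + 1) c I τ) = iteratedDerivWithin (0 + 1) d I τ :=
    hL τ hτ 0
  have hL0 : (L : V →L[ℝ] V) (iteratedDerivWithin (0 + 1) c I τ) =
      iteratedDerivWithin (0 + 1) d I τ := h0
  rw [hL0, sub_self] at hsub
  exact hsub

theorem Orientation.volumeForm_basis_ne_zero (o : Orientation ℝ V (Fin n))
    (e : Module.Basis (Fin n) ℝ V) : o.volumeForm e ≠ 0 := by
  have hn : Module.finrank ℝ V = n := Fact.out
  rw [Ne, AlternatingMap.map_basis_eq_zero_iff]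
  intro h0
  have := o.abs_volumeForm_apply_of_orthonormal ((stdOrthonormalBasis ℝ V).reindex (finCongr hn))
  simp [h0] at this

theorem IsStronglyRegular.volumeForm_curveDerivs_ne_zero (hc : IsStronglyRegular n I c)
    (o : Orientation ℝ V (Fin n)) {t : ℝ} (ht : t ∈ I) :
    o.volumeForm (curveDerivs n I c t) ≠ 0 := by
  obtain ⟨e, he⟩ := hc.exists_basis ht
  exact he ▸ o.volumeForm_basis_ne_zero e

/-- The volume form is continuous and nonvanishing along the curve, so its sign is a continuous map
from a connected set to a discrete space. -/
theorem IsStronglyRegular.hasSgn (hc : IsStronglyRegular n I c) (hI : I.OrdConnected)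
    (hI' : I.Nontrivial) (o : Orientation ℝ V (Fin n)) :
    HasSgn o I c 1 ∨ HasSgn o I c (-1) := by
  have hcont : ContinuousOn (curveSgn o I c) I := fun t ht =>
    ContinuousAt.comp_continuousWithinAt (f := fun t => o.volumeForm (curveDerivs n I c t))
      (continuousAt_sign_of_ne_zero (hc.volumeForm_curveDerivs_ne_zero o ht))
      (o.continuousOn_volumeForm_apply
        (hc.continuousOn_curveDerivs (hI.uniqueDiffOn_of_nontrivial hI')) t ht)
  obtain ⟨s, hs⟩ := hI'.nonempty
  have hconst : ∀ t ∈ I, curveSgn o I c t = curveSgn o I c s := fun t ht =>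
    hI.isPreconnected.constant hcont ht hs
  rcases (hc.volumeForm_curveDerivs_ne_zero o hs).lt_or_gt with hneg | hpos
  · exact .inr fun t ht => (hconst t ht).trans (sign_neg hneg)
  · exact .inl fun t ht => (hconst t ht).trans (sign_pos hpos)

/-- A linear isometry that preserves the sign of the volume of one basis preserves the
orientation. -/
theorem Orientation.map_eq_of_sign_volumeForm_eq (o : Orientation ℝ V (Fin n)) (L : V ≃ₗᵢ[ℝ] V)
    (e : Module.Basis (Fin n) ℝ V)
    (h : SignType.sign (o.volumeForm (L ∘ e)) = SignType.sign (o.volumeForm e)) :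
    Orientation.map (Fin n) L.toLinearEquiv o = o := by
  have hn : Module.finrank ℝ V = n := Fact.out
  refine (Orientation.eq_or_eq_neg _ o (by simp [hn])).resolve_right fun hneg => ?_
  have hmap := o.volumeForm_map L (L ∘ e)
  have hcomp : L.symm ∘ L ∘ e = e := by
    ext i
    simp
  -- If `L` reversed the orientation, the volumes of `e` and `L ∘ e` would be opposite; equal signs
  -- would then force both to vanish.
  rw [hneg, o.volumeForm_neg_orientation, hcomp, AlternatingMap.neg_apply] at hmap
  rw [← hmap, Left.sign_neg] at h
  have h0 : o.volumeForm (L ∘ e) ≠ 0 := fun h0 =>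
    o.volumeForm_basis_ne_zero e (by rw [← hmap, h0, neg_zero])
  exact h0 (sign_eq_zero_iff.1 (SignType.self_eq_neg_iff.1 h))

end Curves

theorem mainTheorem2 {V : Type*} [NormedAddCommGroup V] [InnerProductSpace ℝ V]
    [FiniteDimensional ℝ V] {n : ℕ} [Fact (Module.finrank ℝ V = n)]
    {I : Set ℝ} (hI : I.OrdConnected) (hI_nontrivial : I.Nontrivial) :
    (∀ c d : ℝ → V, IsStronglyRegular n I c → IsStronglyRegular n I d →
        SameDerivNorms n I c d →
        ∃ g : V ≃ᵃⁱ[ℝ] V, ∀ t ∈ I, d t = g (c t)) ∧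
    (∀ o : Orientation ℝ V (Fin n),
      (∀ c : ℝ → V, IsStronglyRegular n I c → HasSgn o I c 1 ∨ HasSgn o I c (-1)) ∧
      (∀ (c d : ℝ → V) (σ : SignType), IsStronglyRegular n I c → IsStronglyRegular n I d →
        SameDerivNorms n I c d → HasSgn o I c σ → HasSgn o I d σ →
        ∃ g : V ≃ᵃⁱ[ℝ] V, Orientation.map (Fin n) g.linearIsometryEquiv.toLinearEquiv o = o ∧
          ∀ t ∈ I, d t = g (c t))) := by
  refine ⟨fun c d hc hd h => ?_, fun o => ⟨fun c hc => hc.hasSgn hI hI_nontrivial o,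
    fun c d σ hc hd h hσc hσd => ?_⟩⟩
  · obtain ⟨g, hg, -⟩ := h.exists_affineIsometryEquiv hI hI_nontrivial hc hd
    exact ⟨g, hg⟩
  · obtain ⟨g, hg, hL⟩ := h.exists_affineIsometryEquiv hI hI_nontrivial hc hd
    obtain ⟨s, hs⟩ := hI_nontrivial.nonempty
    obtain ⟨e, he⟩ := hc.exists_basis hs
    refine ⟨g, o.map_eq_of_sign_volumeForm_eq g.linearIsometryEquiv e ?_, hg⟩
    have hde : g.linearIsometryEquiv ∘ e = curveDerivs n I d s := by
      rw [he]
      exact funext (hL s hs)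
    rw [hde, he]
    exact (hσd s hs).trans (hσc s hs).symm
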